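/- Let $B$ be a finite Blaschke product of order $n\ge 1$, written as $$B(z)=e^{i\beta}z^{j_0}\prod_{k=1}^{m}\left(\frac{z_k-z}{1-\overline{z_k}\,z}\right)^{j_k},$$ where $\beta\in\mathbb R$, $m\ge 0$ and $j_0\ge 0$ are integers, $j_1,\dots,j_m$ are positive integers with $j_0+j_1+\cdots+j_m=n$, and $z_1,\dots,z_m$ are distinct points of $\mathbb D\setminus\{0\}$, $\mathbb D=\{z\in\mathbb C:|z|<1\}$. Then the rational function $B'$ has only finitely many zeros in $\mathbb C$ and, counting zeros with multiplicity: (i) $B'$ has exactly $n-1$ zeros in $\mathbb D$; (ii) if $j_0\neq 0$, then $B'$ has exactly $m$ zeros in $\{z\in\mathbb C:|z|>1\}$, and the point $\infty$ is not a zero of $B'$ (that is, $B'(z)\not\to 0$ as $z\to\infty$), so $B'$ has exactly $m$ zeros in $\{z\in\mathbb C:|z|>1\}\cup\{\infty\}$; (iii) if $j_0=0$, then $B'$ has at most $m-1$ zeros in $\{z\in\mathbb C:|z|>1\}$. -/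

import Mathlib

open Filter Topology

noncomputable section

/-- The finite Blaschke product
`e^{iβ} z^{j₀} ∏ₖ ((aₖ - z) / (1 - conj aₖ z))^{jₖ}`. -/
def finiteBlaschke (β : ℝ) (j₀ : ℕ) {m : ℕ} (a : Fin m → ℂ) (j : Fin m → ℕ) (z : ℂ) : ℂ :=
  Complex.exp (β * Complex.I) * z ^ j₀ *
    ∏ k : Fin m, ((a k - z) / (1 - (starRingEnd ℂ) (a k) * z)) ^ j k

/-- `z` is a zero of the meromorphic function `f`. The order looks only at a punctured
neighbourhood of `z`, so the value that Lean gives to a quotient at a pole plays no role. -/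
def IsZeroAt (f : ℂ → ℂ) (z : ℂ) : Prop :=
  0 < meromorphicOrderAt f z

/-- The multiplicity of `z` as a zero of `f`; it is `0` where `f` has a pole or a
nonzero value. -/
def zeroMult (f : ℂ → ℂ) (z : ℂ) : ℕ :=
  (meromorphicOrderAt f z).untop₀.toNat

/-- The number of zeros of `f` in `S`, counted with multiplicity (meaningful when `f` has
only finitely many zeros in `S`, each of finite order). -/
def numZeros (f : ℂ → ℂ) (S : Set ℂ) : ℕ :=
  ∑ᶠ z ∈ S, zeroMult f z

end

/-!
Logarithmic differentiation of `B = e^{iβ} z^{j₀} ∏ₖ ((aₖ - z) / (1 - conj aₖ z))^{jₖ}` gives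
`z B'(z) / B(z) = j₀ + z ∑ₖ jₖ (1 - |aₖ|²) / qₖ(z)`, where `qₖ(z) = (z - aₖ)(1 - conj aₖ z)`.
Clearing denominators, `z B' = A T / Q` with explicitly factored polynomials `A` (`zeroPart`) and
`Q` (`polePart`), and `T = j₀ ∏ₖ qₖ + z ∑ₖ jₖ (1 - |aₖ|²) ∏_{l ≠ k} q_l` (`critPoly`). The zeros
of `A` are `0` with multiplicity `j₀` and `aₖ` with multiplicity `jₖ - 1`; those of `Q` are the
points `1 / conj aₖ`, where `A T` does not vanish. So everything depends on locating the roots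
of `T`.

The polynomial `T` is self-inversive of formal degree `2m`: `z^{2m} conj (T(1 / conj z)) = T(z)`
(`critPoly_selfInversive`). It has no root on the unit circle, because there `qₖ(z) = z wₖ` with
`wₖ > 0`, so `T(z) = z^m` times a positive number (`critPoly_eval_ne_zero_of_norm_eq_one`). A
self-inversive polynomial of formal degree `2d` without roots on the circle has its nonzero roots
symmetric about the circle, while the root `0` is balanced by the drop `2d - deg` of the degree.
Hence it has exactly `d` roots in the disk, and `d - (2d - deg)` outside
(`Polynomial.countP_roots_of_selfInversive`).

Thus `B'` has `j₀ + ∑ₖ (jₖ - 1) + m - 1 = n - 1` zeros in the disk, the final `-1` coming from the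
factor `z` on the left. Outside it has `deg T - m` zeros; the coefficient of `T` at `z^{2m}` is
`j₀ ∏ₖ (-conj aₖ)`, so this is `m` when `j₀ ≠ 0` and at most `m - 1` when `j₀ = 0`. If `j₀ ≠ 0`,
then `z B' / B → j₀` at infinity while `|B(z)| ≥ |z|` for `|z| > 1`, which keeps `B'` away from `0`.
-/

open Polynomial ComplexConjugate

/-! ### Roots of self-inversive polynomials -/

/-- The roots of a self-inversive polynomial of formal degree `e`: the reflection `r ↦ 1 / conj r` in
the unit circle preserves the nonzero ones with multiplicity, and `0` has as multiplicity the gap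
between `e` and the true degree. -/
theorem Polynomial.roots_eq_of_selfInversive {p : ℂ[X]} {e : ℕ} (hp : p ≠ 0)
    (he : p.natDegree ≤ e)
    (hself : ∀ z : ℂ, z ≠ 0 → z ^ e * conj (p.eval (conj z)⁻¹) = p.eval z) :
    p.roots = Multiset.replicate (e - p.natDegree) 0 +
      (p.roots.filter (· ≠ 0)).map fun r => (conj r)⁻¹ := by
  have hsplit : p.Splits := IsAlgClosed.splits p
  have hcard : p.natDegree = p.roots.card := hsplit.natDegree_eq_card_roots
  -- Reflecting `lc * ∏ (X - r)` in the circle turns each factor `X - r` into `1 - conj r * X`.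
  have key : p = X ^ (e - p.natDegree) * (C (conj p.leadingCoeff) *
      (p.roots.map fun r => 1 - C (conj r) * X).prod) := by
    apply Polynomial.eq_of_infinite_eval_eq
    refine Set.Infinite.mono (s := {(0 : ℂ)}ᶜ) ?_ (Set.finite_singleton _).infinite_compl
    intro z (hz : z ≠ 0)
    have hprod : ∀ s : Multiset ℂ, z ^ s.card * conj ((s.map fun r => (conj z)⁻¹ - r).prod) =
        (s.map fun r => 1 - conj r * z).prod := by
      intro s
      induction s using Multiset.induction_on with
      | empty => simp
      | cons r s ih =>
        simp only [Multiset.card_cons, Multiset.map_cons, Multiset.prod_cons, map_mul, ← ih]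
        simp only [map_sub, map_inv₀, Complex.conj_conj]
        field_simp
        ring
    have h1 : p.eval (conj z)⁻¹ =
        p.leadingCoeff * (p.roots.map fun r => (conj z)⁻¹ - r).prod := by
      conv_lhs => rw [hsplit.eq_prod_roots]
      simp [eval_multiset_prod, Multiset.map_map]
    show p.eval z = _
    rw [← hself z hz, h1]
    simp only [eval_mul, eval_pow, eval_X, eval_C, eval_multiset_prod, Multiset.map_map,
      Function.comp_def, eval_sub, eval_one, ← hprod, map_mul]
    rw [← hcard, ← Nat.sub_add_cancel he, pow_add, Nat.add_sub_cancel]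
    ring
  have hne : ∀ b : ℂ, (1 - C b * X : ℂ[X]) ≠ 0 := fun b h => by
    simpa using congrArg (Polynomial.eval 0) h
  -- A root `r = 0` gives the constant factor `1`, which has no roots.
  have hbind : ∀ s : Multiset ℂ, ((s.map fun r => (1 - C (conj r) * X : ℂ[X])).prod).roots =
      (s.filter (· ≠ 0)).map fun r => (conj r)⁻¹ := by
    intro s
    induction s using Multiset.induction_on with
    | empty => simp
    | cons r s ih =>
      have hs : ((s.map fun r => (1 - C (conj r) * X : ℂ[X])).prod) ≠ 0 := by
        apply Multiset.prod_ne_zero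
        simp only [Multiset.mem_map, not_exists, not_and]
        exact fun r _ => hne _
      rw [Multiset.map_cons, Multiset.prod_cons, roots_mul (mul_ne_zero (hne _) hs), ih]
      by_cases hr : r = 0
      · simp [hr]
      · have : (1 - C (conj r) * X : ℂ[X]) = C (-conj r) * X + C 1 := by
          simp only [map_neg, map_one]; ring
        rw [this, roots_C_mul_X_add_C _ (by simpa using hr)]
        simp [hr]
  have hlc : conj p.leadingCoeff ≠ 0 := by simpa using hp
  conv_lhs => rw [key]
  rw [roots_mul (key ▸ hp), roots_C_mul _ hlc, hbind, roots_X_pow, Multiset.nsmul_singleton]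

/-- Without roots on the unit circle, a self-inversive polynomial of formal degree `2 * d` has `d`
roots in the disk; it has `d` outside as well once the degree drop is counted as roots at
infinity. -/
theorem Polynomial.countP_roots_of_selfInversive {p : ℂ[X]} {d : ℕ} (hp : p ≠ 0)
    (hd : p.natDegree ≤ 2 * d)
    (hself : ∀ z : ℂ, z ≠ 0 → z ^ (2 * d) * conj (p.eval (conj z)⁻¹) = p.eval z)
    (hcirc : ∀ z : ℂ, ‖z‖ = 1 → p.eval z ≠ 0) :
    p.roots.countP (‖·‖ < 1) = d ∧ p.roots.countP (1 < ‖·‖) + (2 * d - p.natDegree) = d := by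
  have hroots := roots_eq_of_selfInversive hp hd hself
  have hcard : p.natDegree = p.roots.card := (IsAlgClosed.splits p).natDegree_eq_card_roots
  have hsymm : p.roots.countP (‖·‖ < 1) =
      (2 * d - p.natDegree) + p.roots.countP (1 < ‖·‖) := by
    conv_lhs => rw [hroots]
    rw [Multiset.countP_add, Multiset.countP_map, Multiset.filter_filter,
      Multiset.countP_eq_card_filter, Multiset.countP_eq_card_filter,
      Multiset.filter_eq_self.2 fun r hr => by simp [Multiset.eq_of_mem_replicate hr],
      Multiset.card_replicate]
    congr 2
    refine Multiset.filter_congr fun r _ => ?_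
    rw [norm_inv, Complex.norm_conj]
    by_cases hr : r = 0
    · simp [hr]
    · simp [hr, inv_lt_one₀ (norm_pos_iff.2 hr)]
  have htotal : p.roots.countP (‖·‖ < 1) + p.roots.countP (1 < ‖·‖) = p.natDegree := by
    rw [hcard, Multiset.card_eq_countP_add_countP (‖·‖ < 1)]
    congr 1
    refine Multiset.countP_congr rfl fun r hr => ?_
    have := hcirc r |>.mt (not_not.2 (isRoot_of_mem_roots hr))
    rw [not_lt, eq_iff_iff]
    exact ⟨le_of_lt, fun h => lt_of_le_of_ne h (Ne.symm this)⟩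
  omega

/-! ### Zeros of functions that agree with a rational function -/

theorem meromorphicOrderAt_polynomial_eval {p : ℂ[X]} (hp : p ≠ 0) (z : ℂ) :
    meromorphicOrderAt (fun w => p.eval w) z = (p.rootMultiplicity z : ℤ) := by
  have hana : ∀ q : ℂ[X], AnalyticAt ℂ (fun w => q.eval w) z := fun q => by
    simpa using AnalyticAt.aeval_polynomial (f := fun w : ℂ => w) analyticAt_id q
  obtain ⟨g, hg, hdvd⟩ := p.exists_eq_pow_rootMultiplicity_mul_and_not_dvd hp z
  refine (meromorphicOrderAt_eq_int_iff (hana p).meromorphicAt).2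
    ⟨fun w => g.eval w, hana g, fun h => hdvd (dvd_iff_isRoot.2 h), ?_⟩
  refine Eventually.of_forall fun w => ?_
  conv_lhs => rw [hg]
  simp

theorem meromorphicOrderAt_polynomial_div {p q : ℂ[X]} (hp : p ≠ 0) (hq : q ≠ 0) (z : ℂ) :
    meromorphicOrderAt (fun w => p.eval w / q.eval w) z =
      ((p.rootMultiplicity z - q.rootMultiplicity z : ℤ) : WithTop ℤ) := by
  have hmer : ∀ r : ℂ[X], MeromorphicAt (fun w => r.eval w) z := fun r => by
    simpa using (AnalyticAt.aeval_polynomial (f := fun w : ℂ => w) analyticAt_id r).meromorphicAt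
  have : (fun w => p.eval w / q.eval w) = (fun w => p.eval w) * (fun w => q.eval w)⁻¹ := by
    ext w; simp [div_eq_mul_inv]
  rw [this, meromorphicOrderAt_mul (hmer p) (hmer q).inv, meromorphicOrderAt_inv,
    meromorphicOrderAt_polynomial_eval hp, meromorphicOrderAt_polynomial_eval hq]
  rw [sub_eq_add_neg]
  rfl

/-- A function that agrees near every point, off the point itself, with a fraction `p / q` without
common zeros has as zeros the roots of `p`, with the same multiplicities. The values of `f` at the
roots of `q` are immaterial. -/
theorem numZeros_eq_countP_roots {f : ℂ → ℂ} {p q : ℂ[X]} (hp : p ≠ 0) (hq : q ≠ 0)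
    (hpq : ∀ z, q.eval z = 0 → p.eval z ≠ 0)
    (hf : ∀ z, f =ᶠ[𝓝[≠] z] fun w => p.eval w / q.eval w) :
    {z | IsZeroAt f z}.Finite ∧ ∀ (P : ℂ → Prop) [DecidablePred P],
      numZeros f {z | P z} = p.roots.countP P := by
  have hord : ∀ z, meromorphicOrderAt f z =
      ((p.rootMultiplicity z - q.rootMultiplicity z : ℤ) : WithTop ℤ) := fun z => by
    rw [meromorphicOrderAt_congr (hf z), meromorphicOrderAt_polynomial_div hp hq]
  have hmult : ∀ z, zeroMult f z = p.roots.count z := fun z => by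
    rw [zeroMult, hord, WithTop.untop₀_coe, count_roots]
    by_cases h : q.eval z = 0
    · rw [rootMultiplicity_eq_zero (hpq z h)]; omega
    · rw [rootMultiplicity_eq_zero (p := q) h]; omega
  constructor
  · refine p.roots.toFinset.finite_toSet.subset fun z hz => ?_
    have h : 0 < meromorphicOrderAt f z := hz
    rw [hord, ← WithTop.coe_zero, WithTop.coe_lt_coe] at h
    have : 0 < p.rootMultiplicity z := by omega
    simpa [hp] using (rootMultiplicity_pos hp).1 this
  · intro P _
    rw [numZeros, finsum_mem_eq_sum_of_inter_support_eq (t := p.roots.toFinset.filter P)]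
    · rw [Multiset.countP_eq_card_filter, ← Multiset.toFinset_sum_count_eq,
        Multiset.toFinset_filter]
      refine Finset.sum_congr rfl fun z hz => ?_
      rw [hmult, Multiset.count_filter_of_pos (Finset.mem_filter.1 hz).2]
    · ext z
      simp only [Set.mem_inter_iff, Set.mem_ofPred_eq, Function.mem_support, hmult, ne_eq,
        Multiset.count_eq_zero, not_not, Finset.coe_filter, Multiset.mem_toFinset]
      tauto

section

variable {m : ℕ}

/-! ### The polynomial carrying the remaining zeros -/

/-- The expression `s + y * ∑ k, c k / u k` multiplied by the common denominator `∏ k, u k`, written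
so that it makes sense also where some `u k` vanishes. -/
noncomputable def numeratorForm (s : ℂ) (c u : Fin m → ℂ) (y : ℂ) : ℂ :=
  s * ∏ k, u k + y * ∑ k, c k * ∏ l ∈ Finset.univ.erase k, u l

theorem numeratorForm_smul (s : ℂ) (c u : Fin m → ℂ) (y : ℂ) {t : ℂ} (ht : t ≠ 0) :
    numeratorForm s c (fun k => t * u k) y = t ^ m * numeratorForm s c u (y / t) := by
  simp only [numeratorForm, Finset.prod_mul_distrib, Finset.prod_const, Finset.card_univ,
    Fintype.card_fin, Finset.mem_univ, Finset.card_erase_of_mem, mul_add, Finset.mul_sum]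
  congr 1
  · ring
  · refine Finset.sum_congr rfl fun k _ => ?_
    obtain ⟨m, rfl⟩ : ∃ i, m = i + 1 := ⟨m - 1, by have := k.pos; omega⟩
    rw [Nat.add_sub_cancel]
    field_simp
    ring

theorem numeratorForm_eq_prod_mul (s : ℂ) (c : Fin m → ℂ) {u : Fin m → ℂ} (y : ℂ)
    (hu : ∀ k, u k ≠ 0) :
    numeratorForm s c u y = (∏ k, u k) * (s + y * ∑ k, c k / u k) := by
  rw [numeratorForm, mul_add, mul_comm s, mul_left_comm _ y, Finset.mul_sum _ _ (∏ k, u k)]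
  congr 2
  refine Finset.sum_congr rfl fun k _ => ?_
  rw [← Finset.mul_prod_erase Finset.univ u (Finset.mem_univ k)]
  field_simp [hu k]

theorem numeratorForm_of_eq_zero (s : ℂ) (c : Fin m → ℂ) {u : Fin m → ℂ} (y : ℂ)
    {k : Fin m} (hk : u k = 0) :
    numeratorForm s c u y = y * (c k * ∏ l ∈ Finset.univ.erase k, u l) := by
  rw [numeratorForm, Finset.prod_eq_zero (Finset.mem_univ k) hk, mul_zero, zero_add,
    Finset.sum_eq_single k _ (by simp)]
  intro l _ hl
  rw [Finset.prod_eq_zero (Finset.mem_erase.2 ⟨hl.symm, Finset.mem_univ k⟩) hk, mul_zero]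

/-- The polynomial `(X - a) (1 - conj a * X)`, the product of the numerator and the denominator of
a Blaschke factor up to sign. -/
noncomputable def factorPoly (a : ℂ) : ℂ[X] := (X - C a) * (1 - C (conj a) * X)

@[simp]
theorem eval_factorPoly (a z : ℂ) :
    (factorPoly a).eval z = (z - a) * (1 - conj a * z) := by
  simp [factorPoly]

theorem natDegree_factorPoly_le (a : ℂ) : (factorPoly a).natDegree ≤ 2 := by
  unfold factorPoly; compute_degree

theorem coeff_factorPoly_two (a : ℂ) : (factorPoly a).coeff 2 = -conj a := by
  have : factorPoly a = C (-conj a) * X ^ 2 + C (1 + a * conj a) * X + C (-a) := by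
    simp only [factorPoly, map_neg, map_add, map_mul, map_one]; ring
  rw [this]
  simp [coeff_one]

theorem one_sub_conj_mul_ne_zero {a z : ℂ} (ha : ‖a‖ < 1) (hz : ‖z‖ ≤ 1) :
    1 - conj a * z ≠ 0 := fun h => by
  have := congrArg norm (sub_eq_zero.1 h)
  rw [norm_one, norm_mul, Complex.norm_conj] at this
  nlinarith [norm_nonneg a, norm_nonneg z]

/-- The polynomial with value `∏ k, q_k * (j₀ + z ∑ k, j_k (1 - |a_k|²) / q_k)` at `z`, where
`q_k = factorPoly (a k)`: the numerator of `z * B' / B`. When `j₀ = 0` the factor `X` is kept, so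
that its formal degree is `2 * m` in all cases. -/
noncomputable def critPoly (j₀ : ℕ) (a : Fin m → ℂ) (j : Fin m → ℕ) : ℂ[X] :=
  C (j₀ : ℂ) * ∏ k, factorPoly (a k) + X * ∑ k, C ((j k : ℂ) * ((1 - ‖a k‖ ^ 2 : ℝ) : ℂ)) *
    ∏ l ∈ Finset.univ.erase k, factorPoly (a l)

theorem eval_critPoly (j₀ : ℕ) (a : Fin m → ℂ) (j : Fin m → ℕ) (z : ℂ) :
    (critPoly j₀ a j).eval z = numeratorForm j₀ (fun k => (j k : ℂ) * ((1 - ‖a k‖ ^ 2 : ℝ) : ℂ))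
      (fun k => (z - a k) * (1 - conj (a k) * z)) z := by
  simp [critPoly, numeratorForm, eval_finsetSum, eval_prod]

theorem natDegree_critPoly_le (j₀ : ℕ) (a : Fin m → ℂ) (j : Fin m → ℕ) :
    (critPoly j₀ a j).natDegree ≤ 2 * m := by
  have hprod : ∀ s : Finset (Fin m), (∏ k ∈ s, factorPoly (a k)).natDegree ≤ 2 * s.card := by
    intro s
    refine (natDegree_prod_le _ _).trans ((Finset.sum_le_card_nsmul _ _ 2
      fun k _ => natDegree_factorPoly_le (a k)).trans ?_)
    rw [smul_eq_mul, mul_comm]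
  refine natDegree_add_le_of_degree_le ?_ ?_
  · exact (natDegree_C_mul_le _ _).trans (by simpa using hprod Finset.univ)
  · rw [Finset.mul_sum]
    refine natDegree_sum_le_of_forall_le _ _ fun k _ => ?_
    refine natDegree_mul_le.trans ?_
    have h1 := (natDegree_C_mul_le ((j k : ℂ) * ((1 - ‖a k‖ ^ 2 : ℝ) : ℂ)) _).trans
      (hprod (Finset.univ.erase k))
    rw [Finset.card_erase_of_mem (Finset.mem_univ k), Finset.card_univ, Fintype.card_fin] at h1
    have := k.pos
    rw [natDegree_X]
    omega

theorem critPoly_selfInversive (j₀ : ℕ) (a : Fin m → ℂ) (j : Fin m → ℕ) {z : ℂ} (hz : z ≠ 0) :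
    z ^ (2 * m) * conj ((critPoly j₀ a j).eval (conj z)⁻¹) = (critPoly j₀ a j).eval z := by
  -- Each factor is self-inversive of formal degree two.
  have h : (fun k => (z - a k) * (1 - conj (a k) * z)) =
      fun k => z ^ 2 * ((z⁻¹ - conj (a k)) * (1 - a k * z⁻¹)) := by
    funext k; field_simp
  rw [eval_critPoly, eval_critPoly, h, numeratorForm_smul _ _ _ _ (pow_ne_zero 2 hz), ← pow_mul]
  congr 1
  have hz' : z / z ^ 2 = z⁻¹ := by field_simp
  simp [numeratorForm, hz', map_sum, map_prod]

theorem critPoly_eval_ne_zero_of_norm_eq_one {j₀ : ℕ} {a : Fin m → ℂ} {j : Fin m → ℕ}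
    (ha : ∀ k, ‖a k‖ < 1) (hn : 0 < j₀ + ∑ k, j k) {z : ℂ} (hz : ‖z‖ = 1) :
    (critPoly j₀ a j).eval z ≠ 0 := by
  have hz0 : z ≠ 0 := norm_ne_zero_iff.1 (by simp [hz])
  have hzz : z * conj z = 1 := by simp [Complex.mul_conj, Complex.normSq_eq_norm_sq, hz]
  have hw : ∀ k, 0 < ‖1 - conj (a k) * z‖ ^ 2 := fun k => by
    have := one_sub_conj_mul_ne_zero (ha k) hz.le
    positivity
  have hc : ∀ k, 0 < 1 - ‖a k‖ ^ 2 := fun k => by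
    have := pow_lt_one₀ (norm_nonneg (a k)) (ha k) two_ne_zero
    linarith
  -- On the circle `z - a = z * conj (1 - conj a * z)`, so the quadratic factor is `z` times a
  -- positive number.
  have h : (fun k => (z - a k) * (1 - conj (a k) * z)) =
      fun k => z * ((‖1 - conj (a k) * z‖ ^ 2 : ℝ) : ℂ) := by
    funext k
    rw [← Complex.normSq_eq_norm_sq, ← Complex.mul_conj]
    simp only [map_sub, map_mul, map_one, Complex.conj_conj]
    linear_combination (1 - conj (a k) * z) * a k * hzz
  rw [eval_critPoly, h, numeratorForm_smul _ _ _ _ hz0, div_self hz0, numeratorForm_eq_prod_mul]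
  · refine mul_ne_zero (pow_ne_zero _ hz0) (mul_ne_zero ?_ ?_)
    · exact Finset.prod_ne_zero_iff.2 fun k _ => Complex.ofReal_ne_zero.2 (hw k).ne'
    · have hpos : 0 < (j₀ : ℝ) +
          ∑ k, (j k : ℝ) * (1 - ‖a k‖ ^ 2) / ‖1 - conj (a k) * z‖ ^ 2 := by
        have hnn : ∀ k ∈ Finset.univ,
            0 ≤ (j k : ℝ) * (1 - ‖a k‖ ^ 2) / ‖1 - conj (a k) * z‖ ^ 2 := fun k _ =>
          div_nonneg (mul_nonneg (Nat.cast_nonneg _) (hc k).le) (hw k).le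
        rcases Nat.eq_zero_or_pos j₀ with h0 | h0
        · obtain ⟨k, hk⟩ : ∃ k, 0 < j k := by
            by_contra! hall
            simp [h0, Nat.le_zero.1 (hall _)] at hn
          refine add_pos_of_nonneg_of_pos (Nat.cast_nonneg _)
            (Finset.sum_pos' hnn ⟨k, Finset.mem_univ k, ?_⟩)
          exact div_pos (mul_pos (Nat.cast_pos.2 hk) (hc k)) (hw k)
        · exact add_pos_of_pos_of_nonneg (Nat.cast_pos.2 h0) (Finset.sum_nonneg hnn)
      have := Complex.ofReal_ne_zero.2 hpos.ne'
      push_cast at this ⊢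
      simpa using this
  · exact fun k => Complex.ofReal_ne_zero.2 (hw k).ne'

theorem coeff_critPoly_two_mul (j₀ : ℕ) (a : Fin m → ℂ) (j : Fin m → ℕ) :
    (critPoly j₀ a j).coeff (2 * m) = j₀ * ∏ k, -conj (a k) := by
  have h1 : (∏ k, factorPoly (a k)).coeff (2 * m) = ∏ k, -conj (a k) := by
    have := coeff_prod_of_natDegree_le Finset.univ (fun k => factorPoly (a k)) 2
      fun k _ => natDegree_factorPoly_le (a k)
    simpa [coeff_factorPoly_two, mul_comm] using this
  rw [critPoly, coeff_add, coeff_C_mul, h1, add_eq_left, Finset.mul_sum, finsetSum_coeff]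
  refine Finset.sum_eq_zero fun k _ => coeff_eq_zero_of_natDegree_lt ?_
  refine natDegree_mul_le.trans_lt ?_
  have h2 : (∏ l ∈ Finset.univ.erase k, factorPoly (a l)).natDegree ≤ (m - 1) * 2 := by
    refine (natDegree_prod_le _ _).trans ((Finset.sum_le_card_nsmul _ _ 2
      fun k _ => natDegree_factorPoly_le (a k)).trans ?_)
    simp
  have h3 := (natDegree_C_mul_le ((j k : ℂ) * ((1 - ‖a k‖ ^ 2 : ℝ) : ℂ)) _).trans h2
  have := k.pos
  rw [natDegree_X]
  omega

/-- At a pole `1 / conj (a k)` only the summand of index `k` survives. -/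
theorem critPoly_eval_ne_zero_of_pole {j₀ : ℕ} {a : Fin m → ℂ} {j : Fin m → ℕ}
    (ha : ∀ k, ‖a k‖ < 1) (hinj : Function.Injective a) (hj : ∀ k, 0 < j k) {z : ℂ} {k : Fin m}
    (hz : 1 - conj (a k) * z = 0) : (critPoly j₀ a j).eval z ≠ 0 := by
  have hz1 : 1 < ‖z‖ := not_le.1 fun h => one_sub_conj_mul_ne_zero (ha k) h hz
  have hz0 : z ≠ 0 := norm_pos_iff.1 (by linarith)
  have hc : (1 - ‖a k‖ ^ 2 : ℝ) ≠ 0 := by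
    have := pow_lt_one₀ (norm_nonneg (a k)) (ha k) two_ne_zero
    linarith
  rw [eval_critPoly, numeratorForm_of_eq_zero _ _ _ (by rw [hz, mul_zero])]
  refine mul_ne_zero hz0 (mul_ne_zero (mul_ne_zero (Nat.cast_ne_zero.2 (hj k).ne')
    (Complex.ofReal_ne_zero.2 hc)) (Finset.prod_ne_zero_iff.2 fun l hl => mul_ne_zero ?_ ?_))
  · exact fun h => (hz1.trans (sub_eq_zero.1 h ▸ ha l)).false
  · intro h
    refine Finset.ne_of_mem_erase hl (hinj ((starRingEnd ℂ).injective ?_))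
    exact mul_right_cancel₀ hz0 ((sub_eq_zero.1 h).symm.trans (sub_eq_zero.1 hz))

theorem countP_roots_critPoly {j₀ : ℕ} {a : Fin m → ℂ} {j : Fin m → ℕ}
    (ha : ∀ k, ‖a k‖ < 1) (hn : 0 < j₀ + ∑ k, j k) :
    (critPoly j₀ a j).roots.countP (‖·‖ < 1) = m ∧
      (critPoly j₀ a j).roots.countP (1 < ‖·‖) + (2 * m - (critPoly j₀ a j).natDegree) = m := by
  refine countP_roots_of_selfInversive ?_ (natDegree_critPoly_le j₀ a j)
    (fun z hz => critPoly_selfInversive j₀ a j hz)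
    (fun z hz => critPoly_eval_ne_zero_of_norm_eq_one ha hn hz)
  intro h
  exact critPoly_eval_ne_zero_of_norm_eq_one ha hn norm_one (by rw [h, eval_zero])

/-! ### The derivative of a Blaschke product -/

theorem logDeriv_blaschkeFactor {a z : ℂ} (h1 : z - a ≠ 0) (h2 : 1 - conj a * z ≠ 0) :
    logDeriv (fun w => (a - w) / (1 - conj a * w)) z =
      ((1 - ‖a‖ ^ 2 : ℝ) : ℂ) / ((z - a) * (1 - conj a * z)) := by
  have h1' : a - z ≠ 0 := fun h => h1 (by linear_combination -h)
  have hd1 : HasDerivAt (fun w : ℂ => a - w) (-1) z := by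
    simpa using (hasDerivAt_id z).const_sub a
  have hd2 : HasDerivAt (fun w : ℂ => 1 - conj a * w) (-conj a) z := by
    simpa using ((hasDerivAt_id z).const_mul (conj a)).const_sub 1
  rw [logDeriv_div z h1' h2 hd1.differentiableAt hd2.differentiableAt, logDeriv_apply,
    logDeriv_apply, hd1.deriv, hd2.deriv, ← Complex.normSq_eq_norm_sq, Complex.ofReal_sub,
    ← Complex.mul_conj, ← neg_sub z a, Complex.ofReal_one,
    div_sub_div _ _ (neg_ne_zero.2 h1) h2,
    div_eq_div_iff (mul_ne_zero (neg_ne_zero.2 h1) h2) (mul_ne_zero h1 h2)]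
  ring

theorem deriv_finiteBlaschke (β : ℝ) (j₀ : ℕ) (a : Fin m → ℂ) (j : Fin m → ℕ) {z : ℂ}
    (hz : z ≠ 0) (h1 : ∀ k, z - a k ≠ 0) (h2 : ∀ k, 1 - conj (a k) * z ≠ 0) :
    deriv (finiteBlaschke β j₀ a j) z = finiteBlaschke β j₀ a j z *
      (j₀ / z + ∑ k, (j k : ℂ) * ((1 - ‖a k‖ ^ 2 : ℝ) : ℂ) /
        ((z - a k) * (1 - conj (a k) * z))) := by
  have h1' : ∀ k, a k - z ≠ 0 := fun k h => h1 k (by linear_combination -h)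
  have hdiff : ∀ k, DifferentiableAt ℂ (fun w => (a k - w) / (1 - conj (a k) * w)) z :=
    fun k => DifferentiableAt.fun_div (by fun_prop) (by fun_prop) (h2 k)
  have hfac : ∀ k, ((a k - z) / (1 - conj (a k) * z)) ^ j k ≠ 0 := fun k =>
    pow_ne_zero _ (div_ne_zero (h1' k) (h2 k))
  have hprod : (∏ k, ((a k - z) / (1 - conj (a k) * z)) ^ j k) ≠ 0 :=
    Finset.prod_ne_zero_iff.2 fun k _ => hfac k
  have hexp := Complex.exp_ne_zero (β * Complex.I)
  have hB : finiteBlaschke β j₀ a j z ≠ 0 := by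
    unfold finiteBlaschke
    exact mul_ne_zero (mul_ne_zero hexp (pow_ne_zero _ hz)) hprod
  have hlog : logDeriv (finiteBlaschke β j₀ a j) z =
      j₀ / z + ∑ k, (j k : ℂ) * ((1 - ‖a k‖ ^ 2 : ℝ) : ℂ) /
        ((z - a k) * (1 - conj (a k) * z)) := by
    unfold finiteBlaschke
    rw [logDeriv_mul (f := fun w => Complex.exp (β * Complex.I) * w ^ j₀)
        (g := fun w => ∏ k, ((a k - w) / (1 - conj (a k) * w)) ^ j k) z
        (mul_ne_zero hexp (pow_ne_zero _ hz)) hprod (by fun_prop)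
        (DifferentiableAt.fun_finsetProd fun k _ => (hdiff k).fun_pow _),
      logDeriv_const_mul z _ hexp, logDeriv_pow,
      logDeriv_prod (fun k _ => hfac k) fun k _ => (hdiff k).fun_pow _]
    congr 1
    refine Finset.sum_congr rfl fun k _ => ?_
    rw [logDeriv_fun_pow (hdiff k), logDeriv_blaschkeFactor (h1 k) (h2 k), mul_div_assoc]
  rw [← hlog, logDeriv_apply, mul_div_cancel₀ _ hB]

/-- The factor of the numerator of `z * B'` whose zeros are those of `B`: `j₀` times the origin and
`j k - 1` times the point `a k`. The constant absorbs the signs from `a k - z = -(z - a k)`. -/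
noncomputable def zeroPart (β : ℝ) (j₀ : ℕ) (a : Fin m → ℂ) (j : Fin m → ℕ) : ℂ[X] :=
  C (Complex.exp (β * Complex.I) * ∏ k, (-1) ^ j k) *
    (X ^ j₀ * ∏ k, (X - C (a k)) ^ (j k - 1))

/-- The denominator of `B'`, with a root of multiplicity `j k + 1` at each `1 / conj (a k)`. -/
noncomputable def polePart (a : Fin m → ℂ) (j : Fin m → ℕ) : ℂ[X] :=
  ∏ k, (1 - C (conj (a k)) * X) ^ (j k + 1)

theorem deriv_finiteBlaschke_eq_div (β : ℝ) (j₀ : ℕ) (a : Fin m → ℂ) (j : Fin m → ℕ)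
    (hj : ∀ k, 0 < j k) {z : ℂ}
    (hz : z ≠ 0) (h1 : ∀ k, z - a k ≠ 0) (h2 : ∀ k, 1 - conj (a k) * z ≠ 0) :
    deriv (finiteBlaschke β j₀ a j) z =
      (zeroPart β j₀ a j * critPoly j₀ a j).eval z / (z * (polePart a j).eval z) := by
  rw [deriv_finiteBlaschke β j₀ a j hz h1 h2, eval_mul, eval_critPoly,
    numeratorForm_eq_prod_mul _ _ _ fun k => mul_ne_zero (h1 k) (h2 k)]
  have hprod : (∏ k, ((a k - z) / (1 - conj (a k) * z)) ^ j k) * (polePart a j).eval z =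
      (∏ k, (-1) ^ j k) * (∏ k, (z - a k) ^ (j k - 1)) *
        ∏ k, ((z - a k) * (1 - conj (a k) * z)) := by
    simp only [polePart, eval_prod, ← Finset.prod_mul_distrib]
    refine Finset.prod_congr rfl fun k _ => ?_
    obtain ⟨i, hi⟩ : ∃ i, j k = i + 1 := ⟨j k - 1, by have := hj k; omega⟩
    have := h2 k
    rw [hi, Nat.add_sub_cancel, ← neg_sub z (a k), neg_div, neg_pow, div_pow]
    simp only [eval_pow, eval_sub, eval_one, eval_mul, eval_C, eval_X]
    generalize 1 - conj (a k) * z = w at this ⊢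
    field_simp
    ring
  have hpole : (polePart a j).eval z ≠ 0 := by
    simp only [polePart, eval_prod, Finset.prod_ne_zero_iff]
    exact fun k _ => by simpa using h2 k
  rw [eq_div_iff (mul_ne_zero hz hpole)]
  simp only [finiteBlaschke, zeroPart, eval_mul, eval_C, eval_pow, eval_X, eval_prod, eval_sub]
  generalize (∑ k, (j k : ℂ) * ((1 - ‖a k‖ ^ 2 : ℝ) : ℂ) /
    ((z - a k) * (1 - conj (a k) * z))) = S
  linear_combination Complex.exp (β * Complex.I) * z ^ j₀ * (j₀ + z * S) * hprod +
    Complex.exp (β * Complex.I) * z ^ j₀ *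
      (∏ k, ((a k - z) / (1 - conj (a k) * z)) ^ j k) * (polePart a j).eval z *
      mul_div_cancel₀ (j₀ : ℂ) hz

/-- Outside the unit disk a Blaschke factor has modulus at least one, by
`|a - z|² - |1 - conj a * z|² = (|z|² - 1) (1 - |a|²)`. -/
theorem one_le_norm_blaschkeFactor {a z : ℂ} (ha : ‖a‖ < 1) (hz : 1 ≤ ‖z‖)
    (h : 1 - conj a * z ≠ 0) : 1 ≤ ‖(a - z) / (1 - conj a * z)‖ := by
  rw [norm_div, one_le_div (norm_pos_iff.2 h)]
  refine (sq_le_sq₀ (norm_nonneg _) (norm_nonneg _)).1 ?_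
  have key : ‖a - z‖ ^ 2 - ‖1 - conj a * z‖ ^ 2 = (‖z‖ ^ 2 - 1) * (1 - ‖a‖ ^ 2) := by
    simp only [← Complex.normSq_eq_norm_sq, Complex.normSq_apply, Complex.sub_re, Complex.sub_im,
      Complex.mul_re, Complex.mul_im, Complex.conj_re, Complex.conj_im, Complex.one_re,
      Complex.one_im]
    ring
  have := mul_nonneg (sub_nonneg.2 (one_le_pow₀ hz : 1 ≤ ‖z‖ ^ 2))
    (sub_nonneg.2 (pow_le_one₀ (norm_nonneg a) ha.le : ‖a‖ ^ 2 ≤ 1))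
  linarith

theorem not_tendsto_deriv_finiteBlaschke_cobounded (β : ℝ) {j₀ : ℕ} (hj₀ : j₀ ≠ 0)
    {a : Fin m → ℂ} (ha : ∀ k, ‖a k‖ < 1) (ha0 : ∀ k, a k ≠ 0) (j : Fin m → ℕ) :
    ¬ Tendsto (deriv (finiteBlaschke β j₀ a j)) (Bornology.cobounded ℂ) (𝓝 0) := by
  intro hlim
  have hnorm : ∀ R : ℝ, ∀ᶠ z in Bornology.cobounded ℂ, R < ‖z‖ := fun R =>
    tendsto_norm_cobounded_atTop.eventually_gt_atTop R
  have hsub : ∀ k, Tendsto (fun z => z - a k) (Bornology.cobounded ℂ) (Bornology.cobounded ℂ) := by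
    intro k
    rw [← tendsto_norm_atTop_iff_cobounded]
    refine tendsto_atTop_mono (f := fun z : ℂ => ‖z‖ - ‖a k‖) (fun z => norm_sub_norm_le z (a k)) ?_
    exact tendsto_atTop_add_const_right _ _ tendsto_norm_cobounded_atTop
  have hpole : ∀ k, Tendsto (fun z => 1 - conj (a k) * z) (Bornology.cobounded ℂ)
      (Bornology.cobounded ℂ) := by
    intro k
    rw [← tendsto_norm_atTop_iff_cobounded]
    refine tendsto_atTop_mono (f := fun z : ℂ => ‖a k‖ * ‖z‖ - 1) (fun z => ?_) ?_
    · have := norm_sub_norm_le (conj (a k) * z) 1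
      rwa [norm_mul, Complex.norm_conj, norm_one, norm_sub_rev] at this
    · exact tendsto_atTop_add_const_right _ _
        (tendsto_norm_cobounded_atTop.const_mul_atTop (norm_pos_iff.2 (ha0 k)))
  have hne : ∀ᶠ z in Bornology.cobounded ℂ, 1 < ‖z‖ ∧
      ∀ k, z - a k ≠ 0 ∧ 1 - conj (a k) * z ≠ 0 := by
    refine (hnorm 1).and (eventually_all.2 fun k => ?_)
    filter_upwards [(tendsto_norm_cobounded_atTop.comp (hsub k)).eventually_gt_atTop 0,
      (tendsto_norm_cobounded_atTop.comp (hpole k)).eventually_gt_atTop 0] with z h1 h2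
    exact ⟨norm_pos_iff.1 h1, norm_pos_iff.1 h2⟩
  -- `L z` is `z * B' z / B z`, in a form whose limit at infinity is visible.
  let L : ℂ → ℂ := fun z => j₀ + ∑ k, (j k : ℂ) * ((1 - ‖a k‖ ^ 2 : ℝ) : ℂ) *
    ((1 + a k * (z - a k)⁻¹) * (1 - conj (a k) * z)⁻¹)
  have hL : Tendsto L (Bornology.cobounded ℂ) (𝓝 j₀) := by
    have : Tendsto L (Bornology.cobounded ℂ) (𝓝 (j₀ + ∑ k : Fin m,
        (j k : ℂ) * ((1 - ‖a k‖ ^ 2 : ℝ) : ℂ) * ((1 + a k * 0) * 0))) :=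
      tendsto_const_nhds.add (tendsto_finsetSum _ fun k _ =>
        ((tendsto_const_nhds.add ((tendsto_inv₀_cobounded.comp (hsub k)).const_mul (a k))).mul
          (tendsto_inv₀_cobounded.comp (hpole k))).const_mul _)
    simpa using this
  -- `|L z| = |z| |B' z| / |B z| ≤ |B' z|`, since `|z| ≤ |B z|`.
  have hL0 : Tendsto L (Bornology.cobounded ℂ) (𝓝 0) := by
    refine squeeze_zero_norm' ?_ (by simpa using hlim.norm)
    filter_upwards [hne] with z ⟨hz, h⟩
    have hz0 : z ≠ 0 := norm_pos_iff.1 (by linarith)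
    have hLz : j₀ / z + ∑ k, (j k : ℂ) * ((1 - ‖a k‖ ^ 2 : ℝ) : ℂ) /
        ((z - a k) * (1 - conj (a k) * z)) = L z / z := by
      simp only [L]
      rw [add_div, Finset.sum_div]
      congr 1
      refine Finset.sum_congr rfl fun k _ => ?_
      have h1 := (h k).1
      have h2 := (h k).2
      field_simp
      ring
    have hB : ‖z‖ ≤ ‖finiteBlaschke β j₀ a j z‖ := by
      rw [finiteBlaschke, norm_mul, norm_mul, Complex.norm_exp_ofReal_mul_I, one_mul, norm_pow,
        norm_prod]
      have h1 : ‖z‖ ≤ ‖z‖ ^ j₀ := le_self_pow₀ hz.le hj₀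
      have h2 : 1 ≤ ∏ k, ‖((a k - z) / (1 - conj (a k) * z)) ^ j k‖ :=
        Finset.one_le_prod fun k _ => by
          rw [norm_pow]
          exact one_le_pow₀ (one_le_norm_blaschkeFactor (ha k) hz.le (h k).2)
      nlinarith [norm_nonneg z]
    rw [deriv_finiteBlaschke β j₀ a j hz0 (fun k => (h k).1) (fun k => (h k).2), hLz, norm_mul,
      norm_div]
    calc ‖L z‖ = ‖z‖ * (‖L z‖ / ‖z‖) := by field_simp
      _ ≤ _ := by gcongr
  exact hj₀ (Nat.cast_eq_zero.1 (tendsto_nhds_unique hL hL0))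

theorem countP_roots_zeroPart (β : ℝ) (j₀ : ℕ) (a : Fin m → ℂ) (j : Fin m → ℕ)
    (P : ℂ → Prop) [DecidablePred P] :
    (zeroPart β j₀ a j).roots.countP P =
      (if P 0 then j₀ else 0) + ∑ k, if P (a k) then j k - 1 else 0 := by
  have hc : Complex.exp (β * Complex.I) * ∏ k, (-1 : ℂ) ^ j k ≠ 0 :=
    mul_ne_zero (Complex.exp_ne_zero _) (Finset.prod_ne_zero_iff.2 fun k _ => by simp)
  have hprod : (∏ k, (X - C (a k)) ^ (j k - 1)) ≠ 0 :=
    Finset.prod_ne_zero_iff.2 fun k _ => pow_ne_zero _ (X_sub_C_ne_zero _)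
  have hpow : ∀ (i : ℕ) (b : ℂ), ((X - C b) ^ i).roots.countP P = if P b then i else 0 := by
    intro i b
    rw [roots_pow, roots_X_sub_C, Multiset.countP_nsmul, ← Multiset.cons_zero,
      Multiset.countP_cons, Multiset.countP_zero]
    split_ifs <;> simp
  rw [zeroPart, roots_C_mul _ hc, roots_mul (mul_ne_zero (pow_ne_zero _ X_ne_zero) hprod),
    roots_prod _ _ hprod, Multiset.countP_add]
  congr 1
  · simpa using hpow j₀ 0
  · refine (map_sum (Multiset.countPAddMonoidHom P)
      (fun k => ((X - C (a k)) ^ (j k - 1)).roots) Finset.univ).trans ?_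
    exact Finset.sum_congr rfl fun k _ => hpow _ _

end

/-! ### Counting the zeros of the derivative -/

theorem theoremT (n m : ℕ) (hn : 1 ≤ n) (β : ℝ) (j₀ : ℕ)
    (a : Fin m → ℂ) (j : Fin m → ℕ)
    (ha : ∀ k, ‖a k‖ < 1) (ha0 : ∀ k, a k ≠ 0) (hinj : Function.Injective a)
    (hj : ∀ k, 0 < j k) (hsum : j₀ + ∑ k, j k = n) :
    -- `B'` has finitely many zeros in the plane, so the counts below are genuine
    {z : ℂ | IsZeroAt (deriv (finiteBlaschke β j₀ a j)) z}.Finite ∧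
    -- exactly `n - 1` zeros in the open unit disk
    numZeros (deriv (finiteBlaschke β j₀ a j)) {z : ℂ | ‖z‖ < 1} = n - 1 ∧
    -- `j₀ ≠ 0`: exactly `m` zeros in the exterior disk, the point at infinity not being a zero
    (j₀ ≠ 0 →
      numZeros (deriv (finiteBlaschke β j₀ a j)) {z : ℂ | 1 < ‖z‖} = m ∧
      ¬ Tendsto (deriv (finiteBlaschke β j₀ a j)) (Bornology.cobounded ℂ) (𝓝 0)) ∧
    -- `j₀ = 0`: at most `m - 1` zeros in the exterior disk (here `1 ≤ m`, as `1 ≤ n`)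
    (j₀ = 0 →
      numZeros (deriv (finiteBlaschke β j₀ a j)) {z : ℂ | 1 < ‖z‖} ≤ m - 1) := by
  have hpos : 0 < j₀ + ∑ k, j k := hsum ▸ hn
  have hT0 : critPoly j₀ a j ≠ 0 := fun h =>
    critPoly_eval_ne_zero_of_norm_eq_one ha hpos norm_one (by rw [h, eval_zero])
  have hA0 : zeroPart β j₀ a j ≠ 0 := by
    refine mul_ne_zero (C_ne_zero.2 (mul_ne_zero (Complex.exp_ne_zero _)
      (Finset.prod_ne_zero_iff.2 fun k _ => by simp))) (mul_ne_zero (pow_ne_zero _ X_ne_zero)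
      (Finset.prod_ne_zero_iff.2 fun k _ => pow_ne_zero _ (X_sub_C_ne_zero _)))
  -- The origin is a root of `zeroPart` if `j₀ ≠ 0`, and of `critPoly` if `j₀ = 0`.
  have hXdvd : X ∣ zeroPart β j₀ a j * critPoly j₀ a j := by
    rw [X_dvd_iff, coeff_zero_eq_eval_zero]
    by_cases h : j₀ = 0
    · simp [critPoly, h]
    · simp [zeroPart, h]
  obtain ⟨P, hP⟩ := hXdvd
  have hP0 : P ≠ 0 := by
    rintro rfl
    exact mul_ne_zero hA0 hT0 (by simpa using hP)
  have hpoleEval : ∀ z, (polePart a j).eval z = 0 → ∃ k, 1 - conj (a k) * z = 0 := fun z h => by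
    rw [polePart, eval_prod, Finset.prod_eq_zero_iff] at h
    obtain ⟨k, -, hk⟩ := h
    exact ⟨k, by simpa using hk⟩
  have hQ0 : polePart a j ≠ 0 := fun h => by
    obtain ⟨k, hk⟩ := hpoleEval 0 (by rw [h, eval_zero])
    simp at hk
  have hPQ : ∀ z, (polePart a j).eval z = 0 → P.eval z ≠ 0 := fun z hz hPz => by
    obtain ⟨k, hk⟩ := hpoleEval z hz
    have hz1 : 1 < ‖z‖ := not_le.1 fun h => one_sub_conj_mul_ne_zero (ha k) h hk
    have hAz : (zeroPart β j₀ a j).eval z ≠ 0 := fun h => by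
      have := (Multiset.countP_pos (p := (1 < ‖·‖))).2
        ⟨z, (mem_roots hA0).2 h, hz1⟩
      rw [countP_roots_zeroPart] at this
      simp [fun k => (ha k).le.not_gt, (zero_le_one' ℝ).not_gt] at this
    refine mul_ne_zero hAz (critPoly_eval_ne_zero_of_pole (j₀ := j₀) ha hinj hj hk) ?_
    rw [← eval_mul, hP, eval_mul, hPz, mul_zero]
  have hloc : ∀ z, deriv (finiteBlaschke β j₀ a j) =ᶠ[𝓝[≠] z]
      fun w => P.eval w / (polePart a j).eval w := fun z => by
    have hne : ∀ p : ℂ[X], p ≠ 0 → ∀ᶠ w in 𝓝[≠] z, p.eval w ≠ 0 := fun p hp =>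
      nhdsNE_le_cofinite z ((p.roots.toFinset.finite_toSet.subset fun w hw => by
        simpa [hp] using hw : {w | ¬ p.eval w ≠ 0}.Finite))
    have hne1 : ∀ᶠ w in 𝓝[≠] z, ∀ k, w - a k ≠ 0 := eventually_all.2 fun k => by
      simpa using hne _ (X_sub_C_ne_zero (a k))
    filter_upwards [hne X X_ne_zero, hne _ hQ0, hne1] with w hw hQ h1
    rw [eval_X] at hw
    have h2 : ∀ k, 1 - conj (a k) * w ≠ 0 := fun k hk => hQ (by
      rw [polePart, eval_prod]
      exact Finset.prod_eq_zero (Finset.mem_univ k) (by simp [hk]))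
    rw [deriv_finiteBlaschke_eq_div β j₀ a j hj hw h1 h2, hP, eval_mul, eval_X,
      mul_div_mul_left _ _ hw]
  obtain ⟨hfin, hnum⟩ := numZeros_eq_countP_roots hP0 hQ0 hPQ hloc
  -- Root counts in `X * P = zeroPart * critPoly`; dividing by `X` costs one root at the origin.
  have hcount : ∀ (S : ℂ → Prop) [DecidablePred S], (if S 0 then 1 else 0) + P.roots.countP S =
      (zeroPart β j₀ a j).roots.countP S + (critPoly j₀ a j).roots.countP S := fun S _ => by
    rw [← Multiset.countP_add, ← roots_mul (mul_ne_zero hA0 hT0), hP,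
      roots_mul (mul_ne_zero X_ne_zero hP0), Multiset.countP_add, roots_X,
      ← Multiset.cons_zero, Multiset.countP_cons, Multiset.countP_zero, zero_add]
  obtain ⟨hin, hout⟩ := countP_roots_critPoly ha hpos
  have hdeg := natDegree_critPoly_le j₀ a j
  have hcoeff := coeff_critPoly_two_mul j₀ a j
  have hexterior : numZeros (deriv (finiteBlaschke β j₀ a j)) {z : ℂ | 1 < ‖z‖} =
      (critPoly j₀ a j).roots.countP (1 < ‖·‖) := by
    have := hcount (1 < ‖·‖)
    rw [countP_roots_zeroPart] at this
    rw [hnum]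
    simpa [fun k => (ha k).le.not_gt, (zero_le_one' ℝ).not_gt] using this
  refine ⟨hfin, ?_, fun h => ⟨?_, ?_⟩, fun h => ?_⟩
  · have hdisk := hcount (‖·‖ < 1)
    rw [countP_roots_zeroPart, hin] at hdisk
    simp only [norm_zero, zero_lt_one, if_true, ha] at hdisk
    have hsplit : ∑ k, j k = ∑ k, (j k - 1) + m := by
      rw [Finset.sum_congr rfl fun k _ => (Nat.sub_add_cancel (hj k)).symm,
        Finset.sum_add_distrib]
      simp
    rw [hnum]
    omega
  · have hlead : (critPoly j₀ a j).coeff (2 * m) ≠ 0 := by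
      rw [hcoeff]
      exact mul_ne_zero (Nat.cast_ne_zero.2 h) (Finset.prod_ne_zero_iff.2 fun k _ => by
        simpa using ha0 k)
    have := le_natDegree_of_ne_zero hlead
    omega
  · exact not_tendsto_deriv_finiteBlaschke_cobounded β h ha ha0 j
  · have hlt : (critPoly j₀ a j).natDegree ≠ 2 * m := fun hd => by
      rw [← hd, h, coeff_natDegree] at hcoeff
      simp at hcoeff
      exact hT0 (h ▸ hcoeff)
    omega
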